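/- Let $n\ge 3$ and $1\le k\le n-1$, and let $p(z)=z^n+a_{n-1}z^{n-1}+\dots+a_1z+a_0$ be a complex polynomial with $a_0\neq 0$, whose zeros, listed with multiplicity, are labeled so that $|z_1|\le|z_2|\le\dots\le|z_n|$. Define the polynomials $p_1(z)=z$ and $p_{j+1}(z)=z\,(p_j(z)+a_{n-j})$ for $1\le j\le n-2$, so that $p_j(z)=z^j+a_{n-1}z^{j-1}+\dots+a_{n-j+1}z$ for $1\le j\le n-1$. Let $P_j$ be obtained from $p_j$ by replacing its coefficients with their moduli, and let $\mu(k,x)=\sum_{j=0}^{k-1}|a_j|x^{j-k}$. Suppose that the polynomial $$f_k(x)=x^n+|a_{n-1}|x^{n-1}+\dots+|a_{k+1}|x^{k+1}-|a_k|x^k+|a_{k-1}|x^{k-1}+\dots+|a_0|$$ has two distinct positive roots $r<R$, and let $$\Omega_1(k)=\{z\in\mathbb C: |p_{n-k}(z)|\le P_{n-k}(r)\},\qquad \Omega_2(k)=\{z\in\mathbb C: |p_{n-k}(z)+a_k|\le \mu(k,R)\}.$$ Then $P_{n-k}(r)=|a_k|-\mu(k,r)$, $\mu(k,R)=|a_k|-P_{n-k}(R)$,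 the sets $\Omega_1(k)$ and $\Omega_2(k)$ are disjoint, and: (1) the zeros $z_1,\dots,z_k$ lie in the closed disk $\{|z|\le r\}$, and the remaining zeros $z_{k+1},\dots,z_n$ lie in $\Omega_2(k)$, which is the closed interior of a lemniscate, i.e. $\Omega_2(k)=\{|q|\le c\}$ with boundary $\{|q|=c\}$ for some nonconstant polynomial $q$ and some $c>0$; (2) $\{|z|\le r\}\subseteq\Omega_1(k)$ and $\Omega_2(k)\subseteq\{|z|\ge R\}$; (3) each connected component of $\Omega_2(k)$ whose boundary is a simple closed (Jordan) curve contains as many zeros of $p$ as zeros of $p_{n-k}+a_k$, counted with multiplicity. -/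

import Mathlib

open Polynomial

noncomputable section

namespace GeometricPellet

/-- The associated polynomials `p_1, p_2, …` of `p = z^n + a_{n-1} z^{n-1} + … + a_0`:
`p_1 = z` and `p_{j+1} = z (p_j + a_{n-j})`. (The value at index `0` is a convention.) -/
def assocPoly (p : ℂ[X]) : ℕ → ℂ[X]
  | 0 => 0
  | 1 => X
  | j + 2 => X * (assocPoly p (j + 1) + C (p.coeff (p.natDegree - (j + 1))))

/-- The real polynomial obtained from `q` by replacing its coefficients with their moduli. -/
def absPoly (q : ℂ[X]) : ℝ[X] :=
  ∑ i ∈ q.support, C ‖q.coeff i‖ * X ^ i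

/-- `μ(k, x) = ∑_{j=0}^{k-1} |a_j| x^{j-k}`. -/
def mu (p : ℂ[X]) (k : ℕ) (x : ℝ) : ℝ :=
  ∑ j ∈ Finset.range k, ‖p.coeff j‖ * x ^ ((j : ℤ) - (k : ℤ))

/-- Pellet's polynomial `f_k`: all coefficients of `p` are replaced by their moduli, except that
the coefficient of index `k` is replaced by `-|a_k|`. -/
def pelletPoly (p : ℂ[X]) (k : ℕ) : ℝ[X] :=
  ∑ j ∈ Finset.range (p.natDegree + 1),
    C (if j = k then -‖p.coeff j‖ else ‖p.coeff j‖) * X ^ j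

/-- `Ω₁(k) = {z : |p_{n-k}(z)| ≤ P_{n-k}(r)}`. -/
def Omega1 (p : ℂ[X]) (k : ℕ) (r : ℝ) : Set ℂ :=
  {z | ‖(assocPoly p (p.natDegree - k)).eval z‖
    ≤ (absPoly (assocPoly p (p.natDegree - k))).eval r}

/-- `Ω₂(k) = {z : |p_{n-k}(z) + a_k| ≤ μ(k, R)}`. -/
def Omega2 (p : ℂ[X]) (k : ℕ) (R : ℝ) : Set ℂ :=
  {z | ‖(assocPoly p (p.natDegree - k)).eval z + p.coeff k‖ ≤ mu p k R}

/-- `S` is the closed interior `{|q| ≤ c}` of a (nondegenerate) lemniscate `{|q| = c}`, with `q` a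
nonconstant polynomial and `c > 0`; the lemniscate is then the boundary of `S`. -/
def IsClosedLemniscateInterior (S : Set ℂ) : Prop :=
  ∃ (q : ℂ[X]) (c : ℝ), 0 < q.natDegree ∧ 0 < c ∧
    S = {z | ‖q.eval z‖ ≤ c} ∧ frontier S = {z | ‖q.eval z‖ = c}

/-- A simple closed curve in the plane: the image of an injective continuous map of the circle. -/
def IsJordanCurve (Γ : Set ℂ) : Prop :=
  ∃ γ : Circle → ℂ, Continuous γ ∧ Function.Injective γ ∧ Set.range γ = Γ

/-- `D` is one of the connected components of `S`. -/
def IsComponentOf (D S : Set ℂ) : Prop :=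
  ∃ z ∈ S, D = connectedComponentIn S z

open Classical in
/-- The number of zeros of `q` in `S`, counted with multiplicity (for `q ≠ 0`). -/
def numZerosIn (q : ℂ[X]) (S : Set ℂ) : ℕ :=
  Multiset.card (q.roots.filter (fun z => z ∈ S))

end GeometricPellet

end

/-! Write `p = X ^ k * u + l` with `u = upper p k`, that is `p_{n-k} + a_k`, and `l = lower p k`.
Dividing `f_k` by `x ^ k` gives `P_{n-k}(x) + μ(k, x) - |a_k|`, which is strictly convex on the
positive axis, hence negative strictly between its zeros `r` and `R`. Deform `X ^ k * u` into `p`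
through `X ^ k * u + t * l`. A zero with `|z| > r` satisfies `|u(z)| ≤ μ(k, |z|)`, so `|a_k| ≤
P_{n-k}(|z|) + μ(k, |z|)`; this forces `|z| ≥ R`, and since `μ` decreases, `z` lies in `Ω₂(k)`
(`mem_of_isRoot_homotopy`). The zeros thus never leave two disjoint compact sets, the disk and
`Ω₂(k)`, and the number in each is constant (`numZerosIn_eq_of_homotopy`). At `t = 0` the disk holds
just the `k`-fold zero at the origin. For (3) the same count is applied to a relatively clopen piece
of `Ω₂(k)` that has the same zeros as the component (`exists_compact_split`). -/

open Polynomial Set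

namespace GeometricPellet

/-! ### Counting zeros and their conservation under homotopy -/

section RootCounting

lemma numZerosIn_prod {n : ℕ} (z : Fin n → ℂ) (S : Set ℂ) [DecidablePred (· ∈ S)] :
    numZerosIn (∏ i, (X - C (z i))) S = (Finset.univ.filter (fun i => z i ∈ S)).card := by
  have h : (∏ i, (X - C (z i))).roots = Finset.univ.val.map z := by
    rw [← roots_multiset_prod_X_sub_C (Finset.univ.val.map z), Multiset.map_map]
    rfl
  rw [numZerosIn, h, Multiset.filter_map, Multiset.card_map, Finset.card_def, Finset.filter_val]
  congr!

lemma numZerosIn_mul {p q : ℂ[X]} (h : p * q ≠ 0) (S : Set ℂ) :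
    numZerosIn (p * q) S = numZerosIn p S + numZerosIn q S := by
  simp [numZerosIn, roots_mul h]

lemma numZerosIn_congr (q : ℂ[X]) {S T : Set ℂ} (h : ∀ z ∈ q.roots, z ∈ S ↔ z ∈ T) :
    numZerosIn q S = numZerosIn q T := by
  classical
  exact congrArg Multiset.card (Multiset.filter_congr h)

lemma numZerosIn_eq_zero (q : ℂ[X]) {S : Set ℂ} (h : ∀ z ∈ q.roots, z ∉ S) :
    numZerosIn q S = 0 := by
  classical
  exact Multiset.card_eq_zero.2 (Multiset.filter_eq_nil.2 h)

lemma numZerosIn_X_pow (k : ℕ) {S : Set ℂ} (h : (0 : ℂ) ∈ S) :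
    numZerosIn (X ^ k) S = k := by
  classical
  rw [numZerosIn, Multiset.filter_eq_self.2]
  · simp
  · intro a ha
    simp only [roots_pow, roots_X] at ha
    have := Multiset.mem_of_mem_nsmul ha
    rw [Multiset.mem_singleton] at this
    rwa [this]

lemma numZerosIn_X_pow_of_notMem (k : ℕ) {S : Set ℂ} (h : (0 : ℂ) ∉ S) :
    numZerosIn (X ^ k) S = 0 := by
  refine numZerosIn_eq_zero _ fun a ha => ?_
  simp only [roots_pow, roots_X] at ha
  have := Multiset.mem_of_mem_nsmul ha
  rw [Multiset.mem_singleton] at this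
  rwa [this]

lemma exists_eq_prod_X_sub_C {n : ℕ} {p : ℂ[X]} (hp : p.Monic) (hn : p.natDegree = n) :
    ∃ z : Fin n → ℂ, p = ∏ i, (X - C (z i)) := by
  have hs := IsAlgClosed.splits p
  obtain ⟨l, hl⟩ := Quot.exists_rep p.roots
  have hl' : (l : Multiset ℂ) = p.roots := hl
  have hlen : l.length = n := by
    rw [← Multiset.coe_card, hl', ← hn, hs.natDegree_eq_card_roots]
  subst hlen
  refine ⟨l.get, ?_⟩
  have h : Finset.univ.val.map l.get = p.roots := by
    rw [Fin.univ_val_map, List.ofFn_get, hl']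
  conv_lhs => rw [hs.eq_prod_roots_of_monic hp, ← h, Multiset.map_map]
  rfl

/-- Along a continuous family of monic polynomials of constant degree, all of whose zeros lie in
the union of two disjoint compact sets, the number of zeros in the first set is constant. -/
theorem numZerosIn_eq_of_homotopy {n : ℕ} (F : ℝ → ℂ[X])
    (hm : ∀ t ∈ Icc (0 : ℝ) 1, (F t).Monic) (hd : ∀ t ∈ Icc (0 : ℝ) 1, (F t).natDegree = n)
    (hc : ∀ w, Continuous fun t => (F t).eval w)
    {K L : Set ℂ} (hK : IsCompact K) (hL : IsCompact L) (hKL : Disjoint K L)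
    (hF : ∀ t ∈ Icc (0 : ℝ) 1, ∀ z, (F t).IsRoot z → z ∈ K ∪ L) :
    numZerosIn (F 0) K = numZerosIn (F 1) K := by
  classical
  -- parameters for which the zeros with labels in `I` are in `K` and the other ones are in `L`
  let T : Finset (Fin n) → Set ℝ := fun I => Prod.fst ''
    ((Icc (0 : ℝ) 1 ×ˢ (univ.pi fun i => if i ∈ I then K else L)) ∩
      {x : ℝ × (Fin n → ℂ) | ∀ w, (F x.1).eval w = ∏ i, (w - x.2 i)})
  -- Projection of a compact set: the labeled zeros range over a product of compacts, and the
  -- factorization is a closed condition, tested at each `w`.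
  have hTc : ∀ I, IsClosed (T I) := by
    intro I
    refine IsCompact.isClosed (IsCompact.image (IsCompact.inter_right ?_ ?_) continuous_fst)
    · refine isCompact_Icc.prod (isCompact_univ_pi fun i => ?_)
      split_ifs <;> assumption
    · rw [ofPred_forall]
      refine isClosed_iInter fun w => isClosed_eq ((hc w).comp continuous_fst) ?_
      fun_prop
  have hTcount : ∀ I, ∀ t ∈ T I, numZerosIn (F t) K = I.card := by
    rintro I _ ⟨⟨t, z⟩, ⟨⟨_, hz⟩, he⟩, rfl⟩
    have hFt : F t = ∏ i, (X - C (z i)) := by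
      refine Polynomial.funext fun w => ?_
      rw [he w, eval_prod]
      simp
    have hI : Finset.univ.filter (fun i => z i ∈ K) = I := by
      ext i
      have hi := hz i (mem_univ i)
      by_cases h : i ∈ I
      · simpa [h] using hi
      · simp only [h, if_false] at hi
        simpa [h] using fun h' => hKL.ne_of_mem h' hi rfl
    change numZerosIn (F t) K = I.card
    rw [hFt, numZerosIn_prod, hI]
  have hTcover : ∀ t ∈ Icc (0 : ℝ) 1, ∃ I, t ∈ T I := by
    intro t ht
    obtain ⟨z, hz⟩ := exists_eq_prod_X_sub_C (hm t ht) (hd t ht)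
    have he : ∀ w, (F t).eval w = ∏ i, (w - z i) := fun w => by
      rw [hz, eval_prod]
      simp
    refine ⟨Finset.univ.filter (fun i => z i ∈ K), (t, z), ⟨⟨ht, fun i _ => ?_⟩, he⟩, rfl⟩
    have hi : z i ∈ K ∪ L := by
      refine hF t ht _ ?_
      rw [IsRoot.def, he, Finset.prod_eq_zero (Finset.mem_univ i) (sub_self _)]
    by_cases h : z i ∈ K
    · simp [h]
    · simpa [h] using hi
  -- The finitely many closed sets `T I` cover the interval and the count is constant on each, so
  -- preimages are closed; a continuous map from an interval to `ℕ` is constant.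
  have hcont : ContinuousOn (fun t => numZerosIn (F t) K) (Icc (0 : ℝ) 1) := by
    refine continuousOn_iff_continuous_domRestrict.2 (continuous_iff_isClosed.2 fun s _ => ?_)
    have h : (Icc (0 : ℝ) 1).domRestrict (fun t => numZerosIn (F t) K) ⁻¹' s
        = Subtype.val ⁻¹' ⋃ I ∈ {I : Finset (Fin n) | I.card ∈ s}, T I := by
      ext ⟨t, ht⟩
      simp only [mem_preimage, domRestrict_apply, mem_iUnion, mem_ofPred_eq, exists_prop]
      constructor
      · intro h
        obtain ⟨I, hI⟩ := hTcover t ht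
        exact ⟨I, by rwa [← hTcount I t hI], hI⟩
      · rintro ⟨I, hI, htI⟩
        rwa [hTcount I t htI]
    rw [h]
    exact ((toFinite _).isClosed_biUnion fun I _ => hTc I).preimage continuous_subtype_val
  exact isPreconnected_Icc.constant hcont (by simp) (by simp)

end RootCounting

/-! ### Components of compact sets and lemniscates -/

section Topological

/-- A component of a compact set is cut out, up to finitely many given points, by a relatively
clopen subset. -/
lemma exists_compact_split {S D : Set ℂ} (hS : IsCompact S) (hD : IsComponentOf D S)
    (E : Finset ℂ) : ∃ U, D ⊆ U ∧ U ⊆ S ∧ IsCompact U ∧ IsCompact (S \ U) ∧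
      ∀ e ∈ E, e ∈ U → e ∈ D := by
  obtain ⟨x, hx, rfl⟩ := hD
  have : CompactSpace S := isCompact_iff_compactSpace.1 hS
  rw [connectedComponentIn_eq_image hx]
  have key : ∀ e : ℂ, ∃ V : Set S, IsClopen V ∧ (⟨x, hx⟩ : S) ∈ V ∧
      ∀ h : e ∈ S, (⟨e, h⟩ : S) ∈ V → (⟨e, h⟩ : S) ∈ connectedComponent (⟨x, hx⟩ : S) := by
    intro e
    by_cases h : ∃ h : e ∈ S, (⟨e, h⟩ : S) ∉ connectedComponent (⟨x, hx⟩ : S)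
    · obtain ⟨h, he⟩ := h
      -- In a compact Hausdorff space a component is the intersection of its clopen neighborhoods,
      -- so some clopen set separates `e` from it.
      rw [connectedComponent_eq_iInter_isClopen, mem_iInter, not_forall] at he
      obtain ⟨⟨V, hV, hxV⟩, heV⟩ := he
      exact ⟨V, hV, hxV, fun _ h' => absurd h' heV⟩
    · push Not at h
      exact ⟨univ, isClopen_univ, mem_univ _, fun h' _ => h h'⟩
  choose V hV hxV hVe using key
  have hW : IsClopen (⋂ e ∈ E, V e) := isClopen_biInter_finset fun e _ => hV e
  refine ⟨Subtype.val '' (⋂ e ∈ E, V e), image_mono ?_, ?_, ?_, ?_, ?_⟩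
  · exact hW.connectedComponent_subset (by simp [hxV])
  · exact Subtype.coe_image_subset _ _
  · exact hW.isClosed.isCompact.image continuous_subtype_val
  · have h := hW.compl.isClosed.isCompact.image continuous_subtype_val
    rwa [image_compl_eq_range_sdiff_image Subtype.val_injective, Subtype.range_coe] at h
  · rintro e he ⟨⟨e', h'⟩, hmem, rfl⟩
    exact ⟨_, hVe e' h' (mem_iInter₂.1 hmem e' he), rfl⟩

/-- A point with `|q| = c` in the interior would be a local maximum of `|q|`; by the maximum modulus
principle `q` would be locally constant, hence constant. -/
lemma isClosedLemniscateInterior {q : ℂ[X]} {c : ℝ} (hq : 0 < q.natDegree) (hc : 0 < c) :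
    IsClosedLemniscateInterior {z | ‖q.eval z‖ ≤ c} := by
  refine ⟨q, c, hq, hc, rfl, ?_⟩
  have hcont : Continuous fun z => ‖q.eval z‖ := q.continuous.norm
  refine Subset.antisymm (frontier_le_subset_eq hcont continuous_const) fun z hz => ?_
  refine ⟨subset_closure (le_of_eq hz), fun hint => ?_⟩
  have hmax : IsLocalMax (norm ∘ fun z => q.eval z) z := by
    filter_upwards [mem_interior_iff_mem_nhds.1 hint] with w hw
    exact hw.trans (le_of_eq (Eq.symm hz))
  have hev := Complex.eventually_eq_of_isLocalMax_norm
    (Filter.Eventually.of_forall fun w => q.differentiable w) hmax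
  have : q = C (q.eval z) := by
    refine Polynomial.eq_of_infinite_eval_eq _ _ ?_
    simpa using infinite_of_mem_nhds z hev
  rw [this, natDegree_C] at hq
  exact hq.false

lemma isCompact_norm_eval_le {q : ℂ[X]} (hq : 0 < q.natDegree) (c : ℝ) :
    IsCompact {z | ‖q.eval z‖ ≤ c} := by
  have := (q.isProperMap_eval (natDegree_pos_iff_degree_pos.1 hq)).isCompact_preimage
    (isCompact_closedBall (0 : ℂ) c)
  simpa [preimage, Metric.closedBall] using this

end Topological

/-! ### Splitting `p` and `f_k` at index `k` -/

section Coefficients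

lemma coeff_assocPoly (p : ℂ[X]) (j : ℕ) (hj : j + 1 ≤ p.natDegree) (hp : p.Monic) (i : ℕ) :
    (assocPoly p (j + 1)).coeff i = if i = 0 then 0 else p.coeff (p.natDegree - (j + 1) + i) := by
  induction j generalizing i with
  | zero =>
    rcases i with _ | _ | i
    · simp [assocPoly]
    · simp [assocPoly, Nat.sub_add_cancel hj, hp]
    · rw [if_neg (by simp), coeff_eq_zero_of_natDegree_lt (p := p) (by lia)]
      simp [assocPoly, coeff_X]
  | succ j ih =>
    have ih := ih (by lia)
    rcases i with _ | i
    · simp [assocPoly]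
    · rw [assocPoly, coeff_X_mul, coeff_add, ih, coeff_C]
      rcases i with _ | i
      · simp only [if_true, zero_add, one_ne_zero, if_false]
        congr 1
        lia
      · simp only [Nat.add_eq_zero_iff, one_ne_zero, and_false, if_false, add_zero]
        congr 1
        lia

variable {p : ℂ[X]} {k : ℕ}

lemma coeff_assocPoly_sub (hp : p.Monic) (hk : k < p.natDegree) (i : ℕ) :
    (assocPoly p (p.natDegree - k)).coeff i = if i = 0 then 0 else p.coeff (k + i) := by
  obtain ⟨j, hj⟩ : ∃ j, p.natDegree - k = j + 1 := ⟨p.natDegree - k - 1, by lia⟩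
  rw [hj, coeff_assocPoly p j (by lia) hp, show p.natDegree - (j + 1) = k by lia]

/-- The quotient of `p` by `X ^ k`, written in terms of the associated polynomial. -/
noncomputable def upper (p : ℂ[X]) (k : ℕ) : ℂ[X] := assocPoly p (p.natDegree - k) + C (p.coeff k)

/-- The remainder of `p` by `X ^ k`. -/
noncomputable def lower (p : ℂ[X]) (k : ℕ) : ℂ[X] := ∑ j ∈ Finset.range k, C (p.coeff j) * X ^ j

lemma coeff_upper (hp : p.Monic) (hk : k < p.natDegree) (i : ℕ) :
    (upper p k).coeff i = p.coeff (k + i) := by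
  rw [upper, coeff_add, coeff_assocPoly_sub hp hk, coeff_C]
  rcases i with _ | i <;> simp

lemma coeff_lower (i : ℕ) : (lower p k).coeff i = if i < k then p.coeff i else 0 := by
  simp [lower, finsetSum_coeff, coeff_X_pow]

lemma eq_upper_add_lower (hp : p.Monic) (hk : k < p.natDegree) :
    p = X ^ k * upper p k + lower p k := by
  ext i
  rw [coeff_add, coeff_X_pow_mul', coeff_lower, coeff_upper hp hk]
  split_ifs with h₁ h₂ h₂
  · lia
  · simp [Nat.add_sub_of_le h₁]
  · simp
  · lia

lemma natDegree_upper (hp : p.Monic) (hk : k < p.natDegree) :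
    (upper p k).natDegree = p.natDegree - k := by
  refine natDegree_eq_of_le_of_coeff_ne_zero ?_ ?_
  · refine natDegree_le_iff_coeff_eq_zero.2 fun i hi => ?_
    rw [coeff_upper hp hk, coeff_eq_zero_of_natDegree_lt (by lia)]
  · rw [coeff_upper hp hk, Nat.add_sub_of_le hk.le, hp.coeff_natDegree]
    exact one_ne_zero

lemma monic_upper (hp : p.Monic) (hk : k < p.natDegree) : (upper p k).Monic := by
  rw [Monic, leadingCoeff, natDegree_upper hp hk, coeff_upper hp hk, Nat.add_sub_of_le hk.le,
    hp.coeff_natDegree]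

lemma degree_lower_lt : (lower p k).degree < k := by
  rw [degree_lt_iff_coeff_zero]
  intro i hi
  rw [coeff_lower, if_neg (by simpa using hi)]

lemma absPoly_eval (q : ℂ[X]) (x : ℝ) {m : ℕ} (hm : q.natDegree < m) :
    (absPoly q).eval x = ∑ i ∈ Finset.range m, ‖q.coeff i‖ * x ^ i := by
  rw [absPoly, eval_finsetSum]
  simp only [eval_mul, eval_C, eval_pow, eval_X]
  refine Finset.sum_subset (fun i hi => ?_) fun i _ hi => ?_
  · have := le_natDegree_of_mem_supp i hi
    simp only [Finset.mem_range]
    lia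
  · rw [notMem_support_iff.1 hi]
    simp

lemma natDegree_assocPoly_lt (hp : p.Monic) (hk : k < p.natDegree) :
    (assocPoly p (p.natDegree - k)).natDegree < p.natDegree - k + 1 := by
  refine Nat.lt_succ_of_le (natDegree_le_iff_coeff_eq_zero.2 fun i hi => ?_)
  rw [coeff_assocPoly_sub hp hk, if_neg (by lia), coeff_eq_zero_of_natDegree_lt (by lia)]

lemma absPoly_assocPoly_eval (hp : p.Monic) (hk : k < p.natDegree) (x : ℝ) :
    (absPoly (assocPoly p (p.natDegree - k))).eval x
      = ∑ i ∈ Finset.range (p.natDegree - k), ‖p.coeff (k + 1 + i)‖ * x ^ (i + 1) := by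
  rw [absPoly_eval _ _ (natDegree_assocPoly_lt hp hk), Finset.sum_range_succ']
  simp [coeff_assocPoly_sub hp hk, add_comm, add_left_comm]

lemma mu_mul_pow (p : ℂ[X]) (k : ℕ) {x : ℝ} (hx : 0 < x) :
    x ^ k * mu p k x = ∑ j ∈ Finset.range k, ‖p.coeff j‖ * x ^ j := by
  rw [mu, Finset.mul_sum]
  refine Finset.sum_congr rfl fun j _ => ?_
  rw [zpow_sub₀ hx.ne', zpow_natCast, zpow_natCast]
  field_simp

lemma pelletPoly_eval (hp : p.Monic) (hk : k < p.natDegree) {x : ℝ} (hx : 0 < x) :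
    (pelletPoly p k).eval x = x ^ k *
      ((absPoly (assocPoly p (p.natDegree - k))).eval x - ‖p.coeff k‖ + mu p k x) := by
  rw [mul_add, mul_sub, mu_mul_pow p k hx, absPoly_assocPoly_eval hp hk, pelletPoly,
    eval_finsetSum, show p.natDegree + 1 = k + 1 + (p.natDegree - k) by lia,
    Finset.sum_range_add, Finset.sum_range_succ, Finset.mul_sum]
  have h₁ : ∀ j ∈ Finset.range k,
      (C (if j = k then -‖p.coeff j‖ else ‖p.coeff j‖) * X ^ j : ℝ[X]).eval x
        = ‖p.coeff j‖ * x ^ j := fun j hj => by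
    rw [if_neg (Finset.mem_range.1 hj).ne]
    simp
  have h₂ : ∀ i ∈ Finset.range (p.natDegree - k),
      (C (if k + 1 + i = k then -‖p.coeff (k + 1 + i)‖ else ‖p.coeff (k + 1 + i)‖)
        * X ^ (k + 1 + i) : ℝ[X]).eval x
        = x ^ k * (‖p.coeff (k + 1 + i)‖ * x ^ (i + 1)) := fun i _ => by
    rw [if_neg (by lia)]
    simp
    ring
  rw [Finset.sum_congr rfl h₁, Finset.sum_congr rfl h₂]
  simp
  ring

end Coefficients

/-! ### Monotonicity and convexity of the majorants -/

section Estimates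

variable {p : ℂ[X]} {k : ℕ}

lemma absPoly_assocPoly_mono (hp : p.Monic) (hk : k < p.natDegree) {x y : ℝ} (hx : 0 ≤ x)
    (hxy : x ≤ y) :
    (absPoly (assocPoly p (p.natDegree - k))).eval x
      ≤ (absPoly (assocPoly p (p.natDegree - k))).eval y := by
  rw [absPoly_assocPoly_eval hp hk, absPoly_assocPoly_eval hp hk]
  gcongr

lemma absPoly_assocPoly_strictMono (hp : p.Monic) (hk : k < p.natDegree) {x y : ℝ} (hx : 0 ≤ x)
    (hxy : x < y) :
    (absPoly (assocPoly p (p.natDegree - k))).eval x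
      < (absPoly (assocPoly p (p.natDegree - k))).eval y := by
  rw [absPoly_assocPoly_eval hp hk, absPoly_assocPoly_eval hp hk]
  -- Strictness comes from the leading term, whose coefficient is `1`.
  refine Finset.sum_lt_sum (fun i _ => by gcongr)
    ⟨p.natDegree - k - 1, Finset.mem_range.2 (by lia), ?_⟩
  rw [show k + 1 + (p.natDegree - k - 1) = p.natDegree by lia, hp.coeff_natDegree]
  have := pow_lt_pow_left₀ hxy hx (Nat.succ_ne_zero (p.natDegree - k - 1))
  simpa using this

lemma norm_eval_assocPoly_le (hp : p.Monic) (hk : k < p.natDegree) (z : ℂ) :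
    ‖(assocPoly p (p.natDegree - k)).eval z‖
      ≤ (absPoly (assocPoly p (p.natDegree - k))).eval ‖z‖ := by
  rw [absPoly_eval _ _ (natDegree_assocPoly_lt hp hk),
    eval_eq_sum_range' (natDegree_assocPoly_lt hp hk)]
  refine (norm_sum_le _ _).trans (le_of_eq ?_)
  simp

lemma mu_pos (hk : 0 < k) (h0 : p.coeff 0 ≠ 0) {x : ℝ} (hx : 0 < x) : 0 < mu p k x := by
  refine Finset.sum_pos' (fun j _ => by positivity) ⟨0, Finset.mem_range.2 hk, ?_⟩
  have := norm_pos_iff.2 h0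
  positivity

lemma mu_anti {x y : ℝ} (hx : 0 < x) (hxy : x ≤ y) : mu p k y ≤ mu p k x := by
  refine Finset.sum_le_sum fun j hj => ?_
  have hj := Finset.mem_range.1 hj
  refine mul_le_mul_of_nonneg_left ?_ (norm_nonneg _)
  rw [← neg_sub (k : ℤ) (j : ℤ), ← Nat.cast_sub hj.le, zpow_neg, zpow_neg, zpow_natCast,
    zpow_natCast]
  gcongr

lemma mu_strictAnti (hk : 0 < k) (h0 : p.coeff 0 ≠ 0) {x y : ℝ} (hx : 0 < x) (hxy : x < y) :
    mu p k y < mu p k x := by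
  have anti : ∀ j < k, y ^ ((j : ℤ) - k) < x ^ ((j : ℤ) - k) := fun j hj => by
    rw [← neg_sub (k : ℤ) (j : ℤ), ← Nat.cast_sub hj.le, zpow_neg, zpow_neg, zpow_natCast,
      zpow_natCast]
    exact inv_strictAnti₀ (by positivity) (pow_lt_pow_left₀ hxy hx.le (by lia))
  refine Finset.sum_lt_sum (fun j hj => mul_le_mul_of_nonneg_left
    (anti j (Finset.mem_range.1 hj)).le (norm_nonneg _)) ⟨0, Finset.mem_range.2 hk, ?_⟩
  exact mul_lt_mul_of_pos_left (anti 0 hk) (norm_pos_iff.2 h0)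

lemma norm_eval_lower_le (p : ℂ[X]) (k : ℕ) {z : ℂ} (hz : z ≠ 0) :
    ‖(lower p k).eval z‖ ≤ ‖z‖ ^ k * mu p k ‖z‖ := by
  rw [mu_mul_pow p k (norm_pos_iff.2 hz), lower, eval_finsetSum]
  refine (norm_sum_le _ _).trans (le_of_eq ?_)
  simp

/-- Every term is a nonnegative multiple of an integer power, hence convex; the term `|a_0| x ^
(-k)` is strictly convex because `a_0 ≠ 0` and `k > 0`. -/
lemma strictConvexOn_absPoly_add_mu (hp : p.Monic) (hk : k < p.natDegree) (hk0 : 0 < k)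
    (h0 : p.coeff 0 ≠ 0) :
    StrictConvexOn ℝ (Ioi 0)
      (fun x => (absPoly (assocPoly p (p.natDegree - k))).eval x + mu p k x) := by
  have hsum : ∀ (s : Finset ℕ) (c : ℕ → ℝ) (m : ℕ → ℤ), (∀ i, 0 ≤ c i) →
      ConvexOn ℝ (Ioi 0) (fun x : ℝ => ∑ i ∈ s, c i * x ^ m i) := by
    intro s c m hc
    induction s using Finset.induction_on with
    | empty => simpa using convexOn_const (0 : ℝ) (convex_Ioi (0 : ℝ))
    | insert a s ha ih =>
      simp only [Finset.sum_insert ha]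
      exact ((convexOn_zpow (m a)).smul (hc a)).add ih
  have h₁ : ConvexOn ℝ (Ioi 0)
      (fun x : ℝ => (absPoly (assocPoly p (p.natDegree - k))).eval x) := by
    simp only [absPoly_assocPoly_eval hp hk]
    exact_mod_cast hsum _ (fun i => ‖p.coeff (k + 1 + i)‖) (fun i => ((i + 1 : ℕ) : ℤ))
      fun i => norm_nonneg _
  refine h₁.add_strictConvexOn ?_
  obtain ⟨m, rfl⟩ : ∃ m, k = m + 1 := ⟨k - 1, by lia⟩
  have h₂ : StrictConvexOn ℝ (Ioi 0)
      (fun x : ℝ => ‖p.coeff 0‖ * x ^ (((0 : ℕ) : ℤ) - ((m + 1 : ℕ) : ℤ))) := by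
    have h := strictConvexOn_zpow (m := ((0 : ℕ) : ℤ) - ((m + 1 : ℕ) : ℤ)) (by lia) (by lia)
    refine ⟨h.1, fun x hx y hy hxy a b ha hb hab => ?_⟩
    have := mul_lt_mul_of_pos_left (h.2 hx hy hxy ha hb hab) (norm_pos_iff.2 h0)
    simp only [smul_eq_mul] at this ⊢
    linarith
  unfold mu
  simp only [Finset.sum_range_succ' _ m]
  exact (hsum _ (fun i => ‖p.coeff (i + 1)‖)
    (fun i => ((i + 1 : ℕ) : ℤ) - ((m + 1 : ℕ) : ℤ)) fun i => norm_nonneg _).add_strictConvexOn h₂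

end Estimates

/-! ### Location and number of the zeros -/

section Pellet

variable {p : ℂ[X]} {k : ℕ} {r R : ℝ}

lemma absPoly_add_mu_of_isRoot (hp : p.Monic) (hk : k < p.natDegree) {x : ℝ} (hx : 0 < x)
    (h : (pelletPoly p k).IsRoot x) :
    (absPoly (assocPoly p (p.natDegree - k))).eval x + mu p k x = ‖p.coeff k‖ := by
  rw [IsRoot.def, pelletPoly_eval hp hk hx] at h
  have := (mul_eq_zero.1 h).resolve_left (by positivity)
  linarith

/-- The homotopy from `X ^ k * upper p k` to `p`. -/
noncomputable def homotopy (p : ℂ[X]) (k : ℕ) (t : ℝ) : ℂ[X] := X ^ k * upper p k + C (t : ℂ) * lower p k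

lemma degree_C_mul_lower_lt (hp : p.Monic) (hk : k < p.natDegree) (t : ℝ) :
    (C (t : ℂ) * lower p k).degree < (X ^ k * upper p k).degree := by
  rw [degree_mul (p := X ^ k), degree_X_pow]
  calc (C (t : ℂ) * lower p k).degree ≤ (lower p k).degree := by
        rw [← smul_eq_C_mul]
        exact degree_smul_le _ _
    _ < k := degree_lower_lt
    _ ≤ k + (upper p k).degree := by
        rw [degree_eq_natDegree (monic_upper hp hk).ne_zero]
        exact_mod_cast Nat.le_add_right _ _

lemma monic_homotopy (hp : p.Monic) (hk : k < p.natDegree) (t : ℝ) : (homotopy p k t).Monic :=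
  ((monic_X_pow k).mul (monic_upper hp hk)).add_of_left (degree_C_mul_lower_lt hp hk t)

lemma natDegree_homotopy (hp : p.Monic) (hk : k < p.natDegree) (t : ℝ) :
    (homotopy p k t).natDegree = p.natDegree := by
  rw [homotopy, natDegree_add_eq_left_of_degree_lt (degree_C_mul_lower_lt hp hk t),
    (monic_X_pow k).natDegree_mul (monic_upper hp hk), natDegree_X_pow, natDegree_upper hp hk]
  lia

lemma homotopy_zero : homotopy p k 0 = X ^ k * upper p k := by simp [homotopy]

lemma homotopy_one (hp : p.Monic) (hk : k < p.natDegree) : homotopy p k 1 = p := by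
  conv_rhs => rw [eq_upper_add_lower hp hk]
  simp [homotopy]

lemma Omega2_eq : Omega2 p k R = {z | ‖(upper p k).eval z‖ ≤ mu p k R} := by
  simp [Omega2, upper]

lemma isCompact_Omega2 (hp : p.Monic) (hk : k < p.natDegree) : IsCompact (Omega2 p k R) := by
  rw [Omega2_eq]
  exact isCompact_norm_eval_le (by rw [natDegree_upper hp hk]; lia) _

lemma closedBall_subset_Omega1 (hp : p.Monic) (hk : k < p.natDegree) :
    Metric.closedBall (0 : ℂ) r ⊆ Omega1 p k r := fun z hz => by
  rw [mem_closedBall_zero_iff] at hz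
  exact (norm_eval_assocPoly_le hp hk z).trans
    (absPoly_assocPoly_mono hp hk (norm_nonneg z) hz)

/-- If `|z| < R`, then `|p_{n-k}(z)| < P_{n-k}(R) = |a_k| - μ(k, R)`, which keeps `p_{n-k}(z) + a_k`
farther than `μ(k, R)` from `0`. -/
lemma Omega2_subset (hp : p.Monic) (hk : k < p.natDegree) (hR : 0 < R)
    (hfR : (pelletPoly p k).IsRoot R) : Omega2 p k R ⊆ (Metric.ball (0 : ℂ) R)ᶜ := by
  intro z hz hlt
  rw [mem_ball_zero_iff] at hlt
  have h₁ := absPoly_add_mu_of_isRoot hp hk hR hfR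
  have h₂ := absPoly_assocPoly_strictMono hp hk (norm_nonneg z) hlt
  have h₃ := norm_eval_assocPoly_le hp hk z
  have h₄ : ‖(assocPoly p (p.natDegree - k)).eval z + p.coeff k‖ ≤ mu p k R := hz
  have h₅ := norm_sub_le ((assocPoly p (p.natDegree - k)).eval z + p.coeff k)
    ((assocPoly p (p.natDegree - k)).eval z)
  rw [add_sub_cancel_left] at h₅
  linarith

/-- A common point would give `|a_k| ≤ P_{n-k}(r) + μ(k, R) < P_{n-k}(r) + μ(k, r) = |a_k|`. -/
lemma disjoint_Omega (hp : p.Monic) (hk : k < p.natDegree) (hk0 : 0 < k) (h0 : p.coeff 0 ≠ 0)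
    (hr : 0 < r) (hrR : r < R) (hfr : (pelletPoly p k).IsRoot r) :
    Disjoint (Omega1 p k r) (Omega2 p k R) := by
  refine disjoint_left.2 fun z h₁ h₂ => ?_
  have h₃ := absPoly_add_mu_of_isRoot hp hk hr hfr
  have h₄ := mu_strictAnti hk0 h0 hr hrR
  have h₅ := norm_sub_le ((assocPoly p (p.natDegree - k)).eval z + p.coeff k)
    ((assocPoly p (p.natDegree - k)).eval z)
  rw [add_sub_cancel_left] at h₅
  simp only [Omega1, Omega2, mem_ofPred_eq] at h₁ h₂
  linarith

lemma mem_of_isRoot_homotopy (hp : p.Monic) (hk : k < p.natDegree) (hk0 : 0 < k)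
    (h0 : p.coeff 0 ≠ 0) (hr : 0 < r) (hrR : r < R) (hfr : (pelletPoly p k).IsRoot r)
    (hfR : (pelletPoly p k).IsRoot R) {t : ℝ} (ht : t ∈ Icc (0 : ℝ) 1) {z : ℂ}
    (hz : (homotopy p k t).IsRoot z) : z ∈ Metric.closedBall (0 : ℂ) r ∪ Omega2 p k R := by
  by_cases hzr : ‖z‖ ≤ r
  · exact Or.inl (by simpa using hzr)
  push Not at hzr
  right
  have hzpos : 0 < ‖z‖ := hr.trans hzr
  have hup : ‖(upper p k).eval z‖ ≤ mu p k ‖z‖ := by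
    have he : z ^ k * (upper p k).eval z = -(t * (lower p k).eval z) := by
      rw [IsRoot.def, homotopy] at hz
      simp only [eval_add, eval_mul, eval_pow, eval_X, eval_C] at hz
      exact eq_neg_of_add_eq_zero_left hz
    have hn := congrArg norm he
    rw [norm_mul, norm_pow, norm_neg, norm_mul, Complex.norm_real, Real.norm_of_nonneg ht.1] at hn
    have hl := norm_eval_lower_le p k (norm_pos_iff.1 hzpos)
    have : t * ‖(lower p k).eval z‖ ≤ ‖(lower p k).eval z‖ :=
      mul_le_of_le_one_left (norm_nonneg _) ht.2
    exact le_of_mul_le_mul_left ((hn.le.trans this).trans hl) (by positivity)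
  rw [Omega2_eq]
  rcases le_or_gt R ‖z‖ with hR | hR
  · exact hup.trans (mu_anti (hr.trans hrR) hR)
  · exfalso
    -- Strict convexity puts `P_{n-k} + μ` below `|a_k|` at `|z|`, against the triangle inequality
    -- for `a_k = (p_{n-k}(z) + a_k) - p_{n-k}(z)`.
    have hc := (strictConvexOn_absPoly_add_mu hp hk hk0 h0).lt_on_openSegment
      (x := r) (y := R) (z := ‖z‖) hr (hr.trans hrR) hrR.ne
      (by rw [openSegment_eq_Ioo hrR]; exact ⟨hzr, hR⟩)
    simp only [absPoly_add_mu_of_isRoot hp hk hr hfr,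
      absPoly_add_mu_of_isRoot hp hk (hr.trans hrR) hfR, max_self] at hc
    have h₁ := norm_eval_assocPoly_le hp hk z
    have h₂ : ‖(assocPoly p (p.natDegree - k)).eval z + p.coeff k‖ ≤ mu p k ‖z‖ := by
      simpa [upper] using hup
    have h₃ := norm_sub_le ((assocPoly p (p.natDegree - k)).eval z + p.coeff k)
      ((assocPoly p (p.natDegree - k)).eval z)
    rw [add_sub_cancel_left] at h₃
    linarith

/-- If the union of the closed disk of radius `r` and `Ω₂(k)` is partitioned into two compact sets,
then each part contains as many zeros of `p` as of `z ^ k (p_{n-k}(z) + a_k)`. -/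
lemma numZerosIn_eq_of_split (hp : p.Monic) (hk : k < p.natDegree) (hk0 : 0 < k)
    (h0 : p.coeff 0 ≠ 0) (hr : 0 < r) (hrR : r < R) (hfr : (pelletPoly p k).IsRoot r)
    (hfR : (pelletPoly p k).IsRoot R) {K L : Set ℂ} (hK : IsCompact K) (hL : IsCompact L)
    (hKL : Disjoint K L) (hsub : Metric.closedBall (0 : ℂ) r ∪ Omega2 p k R ⊆ K ∪ L) :
    numZerosIn p K = numZerosIn (X ^ k) K + numZerosIn (upper p k) K := by
  have h := numZerosIn_eq_of_homotopy (homotopy p k) (fun t _ => monic_homotopy hp hk t)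
    (fun t _ => natDegree_homotopy hp hk t)
    (fun w => by simp only [homotopy, eval_add, eval_mul, eval_C]; fun_prop) hK hL hKL
    (fun t ht z hz => hsub (mem_of_isRoot_homotopy hp hk hk0 h0 hr hrR hfr hfR ht hz))
  rw [homotopy_zero, homotopy_one hp hk,
    numZerosIn_mul ((monic_X_pow k).mul (monic_upper hp hk)).ne_zero] at h
  exact h.symm

lemma numZerosIn_closedBall (hp : p.Monic) (hk : k < p.natDegree) (hk0 : 0 < k)
    (h0 : p.coeff 0 ≠ 0) (hr : 0 < r) (hrR : r < R) (hfr : (pelletPoly p k).IsRoot r)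
    (hfR : (pelletPoly p k).IsRoot R) : numZerosIn p (Metric.closedBall (0 : ℂ) r) = k := by
  have hdisj : Disjoint (Metric.closedBall (0 : ℂ) r) (Omega2 p k R) :=
    (disjoint_Omega hp hk hk0 h0 hr hrR hfr).mono_left (closedBall_subset_Omega1 hp hk)
  rw [numZerosIn_eq_of_split hp hk hk0 h0 hr hrR hfr hfR (isCompact_closedBall _ _)
    (isCompact_Omega2 hp hk) hdisj Subset.rfl, numZerosIn_X_pow k (by simp [hr.le]),
    numZerosIn_eq_zero (upper p k), add_zero]
  intro z hz
  refine disjoint_right.1 hdisj ?_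
  rw [Omega2_eq, mem_ofPred_eq, IsRoot.def.1 (isRoot_of_mem_roots hz), norm_zero]
  exact (mu_pos hk0 h0 (hr.trans hrR)).le

lemma numZerosIn_component (hp : p.Monic) (hk : k < p.natDegree) (hk0 : 0 < k)
    (h0 : p.coeff 0 ≠ 0) (hr : 0 < r) (hrR : r < R) (hfr : (pelletPoly p k).IsRoot r)
    (hfR : (pelletPoly p k).IsRoot R) {D : Set ℂ} (hD : IsComponentOf D (Omega2 p k R)) :
    numZerosIn p D = numZerosIn (upper p k) D := by
  have hdisj : Disjoint (Metric.closedBall (0 : ℂ) r) (Omega2 p k R) :=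
    (disjoint_Omega hp hk hk0 h0 hr hrR hfr).mono_left (closedBall_subset_Omega1 hp hk)
  -- `U` avoids the zeros of both polynomials outside `D`, so counts in `U` and `D` agree. The
  -- complementary part is the disk together with `Ω₂(k) \ U`.
  obtain ⟨U, hDU, hU, hUc, hUc', hroots⟩ := exists_compact_split (isCompact_Omega2 hp hk) hD
    (p.roots.toFinset ∪ (upper p k).roots.toFinset)
  have h0U : (0 : ℂ) ∉ U := fun h =>
    Omega2_subset hp hk (hr.trans hrR) hfR (hU h) (by simpa using hr.trans hrR)
  rw [numZerosIn_congr p (T := U), numZerosIn_congr (upper p k) (T := U),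
    numZerosIn_eq_of_split hp hk hk0 h0 hr hrR hfr hfR hUc
      ((isCompact_closedBall 0 r).union hUc') ?_ ?_, numZerosIn_X_pow_of_notMem k h0U, zero_add]
  · exact disjoint_union_right.2 ⟨(hdisj.mono_right hU).symm, disjoint_sdiff_right⟩
  · refine union_subset (subset_union_left.trans subset_union_right) fun z hz => ?_
    by_cases h : z ∈ U
    · exact Or.inl h
    · exact Or.inr (Or.inr ⟨hz, h⟩)
  · exact fun z hz => ⟨fun h => hDU h, hroots z (by simpa using Or.inr (by simpa using hz))⟩
  · exact fun z hz => ⟨fun h => hDU h, hroots z (by simpa using Or.inl (by simpa using hz))⟩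

end Pellet

/-- A downward closed set of indices is determined by its cardinality. -/
lemma mem_iff_lt_of_card {n k : ℕ} {s : Finset (Fin n)} (hs : IsLowerSet (s : Set (Fin n)))
    (hcard : s.card = k) (i : Fin n) : i ∈ s ↔ (i : ℕ) < k := by
  constructor
  · intro hi
    have : Finset.Iic i ⊆ s := fun j hj => hs (Finset.mem_Iic.1 hj) hi
    have := Finset.card_le_card this
    rw [Fin.card_Iic] at this
    lia
  · intro hi
    by_contra h
    have : s ⊆ Finset.Iio i := fun j hj => Finset.mem_Iio.2 (by
      by_contra hij
      exact h (hs (not_lt.1 hij) hj))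
    have := Finset.card_le_card this
    rw [Fin.card_Iio] at this
    lia

end GeometricPellet

open GeometricPellet in
theorem theorem3p1 (n k : ℕ) (hn : 3 ≤ n) (hk1 : 1 ≤ k) (hkn : k ≤ n - 1)
    (p : Polynomial ℂ) (hp : p.Monic) (hdeg : p.natDegree = n) (h0 : p.coeff 0 ≠ 0)
    (r R : ℝ) (hr : 0 < r) (hrR : r < R)
    (hfr : (GeometricPellet.pelletPoly p k).IsRoot r)
    (hfR : (GeometricPellet.pelletPoly p k).IsRoot R) :
    -- the two expressions for each of the radii agree, and the two sets are disjoint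
    ((GeometricPellet.absPoly (GeometricPellet.assocPoly p (n - k))).eval r
        = ‖p.coeff k‖ - GeometricPellet.mu p k r ∧
      GeometricPellet.mu p k R
        = ‖p.coeff k‖
          - (GeometricPellet.absPoly (GeometricPellet.assocPoly p (n - k))).eval R ∧
      Disjoint (GeometricPellet.Omega1 p k r) (GeometricPellet.Omega2 p k R)) ∧
    -- (1), for the zeros listed with multiplicity by nondecreasing modulus
    ((∀ z : Fin n → ℂ, p = ∏ i, (Polynomial.X - Polynomial.C (z i)) →
        Monotone (fun i => ‖z i‖) →
        (∀ i : Fin n, (i : ℕ) < k → z i ∈ Metric.closedBall (0 : ℂ) r) ∧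
        (∀ i : Fin n, k ≤ (i : ℕ) → z i ∈ GeometricPellet.Omega2 p k R)) ∧
      GeometricPellet.IsClosedLemniscateInterior (GeometricPellet.Omega2 p k R)) ∧
    -- (2)
    (Metric.closedBall (0 : ℂ) r ⊆ GeometricPellet.Omega1 p k r ∧
      GeometricPellet.Omega2 p k R ⊆ (Metric.ball (0 : ℂ) R)ᶜ) ∧
    -- (3)
    (∀ D : Set ℂ, GeometricPellet.IsComponentOf D (GeometricPellet.Omega2 p k R) →
      GeometricPellet.IsJordanCurve (frontier D) →
      GeometricPellet.numZerosIn p D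
        = GeometricPellet.numZerosIn
            (GeometricPellet.assocPoly p (n - k) + Polynomial.C (p.coeff k)) D) := by
  classical
  subst hdeg
  have hk : k < p.natDegree := by lia
  have hk0 : 0 < k := hk1
  have hR : 0 < R := hr.trans hrR
  have hdisj := disjoint_Omega hp hk hk0 h0 hr hrR hfr
  have hball := closedBall_subset_Omega1 (r := r) hp hk
  refine ⟨⟨?_, ?_, hdisj⟩, ⟨?_, ?_⟩, ⟨hball, Omega2_subset hp hk hR hfR⟩, ?_⟩
  · linarith [absPoly_add_mu_of_isRoot hp hk hr hfr]
  · linarith [absPoly_add_mu_of_isRoot hp hk hR hfR]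
  · intro z hz hmono
    have hcount := numZerosIn_closedBall hp hk hk0 h0 hr hrR hfr hfR
    rw [congrArg (fun q => numZerosIn q (Metric.closedBall (0 : ℂ) r)) hz, numZerosIn_prod]
      at hcount
    -- Ordering by modulus makes the indices of zeros in the disk a lower set; having `k` elements,
    -- it consists of the first `k` indices.
    have hmem := mem_iff_lt_of_card (fun i j hij hi => by
      simp only [Finset.coe_filter, Finset.mem_univ, true_and, mem_ofPred_eq,
        mem_closedBall_zero_iff] at hi ⊢
      exact (hmono hij).trans hi) hcount
    simp only [Finset.mem_filter, Finset.mem_univ, true_and] at hmem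
    refine ⟨fun i hi => (hmem i).2 hi, fun i hi => ?_⟩
    have hroot : (homotopy p k 1).IsRoot (z i) := by
      rw [homotopy_one hp hk, IsRoot.def, congrArg (eval (z i)) hz, eval_prod]
      exact Finset.prod_eq_zero (Finset.mem_univ i) (by simp)
    exact (mem_of_isRoot_homotopy hp hk hk0 h0 hr hrR hfr hfR (by simp) hroot).resolve_left
      fun h => hi.not_gt ((hmem i).1 h)
  · rw [Omega2_eq]
    exact isClosedLemniscateInterior (by rw [natDegree_upper hp hk]; lia) (mu_pos hk0 h0 hR)
  · intro D hD _
    exact numZerosIn_component hp hk hk0 h0 hr hrR hfr hfR hD
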